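/- Let $X$ be a complex Banach space, let $A$ be the generator of a bounded analytic ($C_0$-)semigroup $(e^{tA})_{t\ge 0}$ on $X$, let $0<T<\infty$, $u_0\in X$ and $f:[0,\infty)\times X\to X$. Assume: (i) (local Lipschitz continuity) for every $R$ there is a constant $L_R$ such that $\|f(t,x)-f(t,y)\|\le L_R\|x-y\|$ for all $t\in[0,T]$ and all $x,y\in X$ with $\|x\|,\|y\|\le R$; (ii) (smoothness in $t$ and $u$) for every integer $\ell\ge 0$ and every $R$ there is a constant $C_{\ell,R}$ such that for every interval $[a,b]\subset[0,T]$ with $a<b$ and every curve $v\in C^\ell([a,b];X)$ the function $t\mapsto f(t,v(t))$ belongs to $C^\ell([a,b];X)$, and at every $t\in[a,b]$ with $\|v(t)\|\le R$ $$ \Big\|\frac{\mathrm d^\ell}{\mathrm dt^\ell} f(t,v(t))\Big\|\le C_{\ell,R}\sum_{j=0}^{\ell}\ \sum_{m_1+\cdots+m_j\le \ell}\|\partial_t^{m_1}v(t)\|\cdots\|\partial_t^{m_j}v(t)\| , $$ where the inner sum extends over all positive integers $m_1,\dots,m_j$ with $m_1+\cdots+m_j\le\ell$, and the term with $j=0$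 is $1$. Let $u\in C([0,T];X)$ be a mild solution of $u'(t)-Au(t)=f(t,u(t))$, $t\in(0,T]$, $u(0)=u_0$, that is, $$ u(t)=e^{tA}u_0+\int_0^t e^{(t-s)A}f(s,u(s))\,\mathrm ds ,\qquad t\in(0,T]. $$ Then for every integer $k\ge 0$ we have $u\in C^k((0,T];X)$, and there is a constant $C$ such that $$ \|\partial_t^\ell u(t)\|\le C\,t^{-\ell}\qquad\text{for all } t\in(0,T],\ \ \ell=0,1,\dots,k $$ (at the end point $T$, and at the end points of $[a,b]$ in (ii), derivatives are one-sided). -/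

import Mathlib

open Set Filter Topology

/-- The open sector `{z ≠ 0 : |arg z| < δ}` of the complex plane. -/
def openSector (δ : ℝ) : Set ℂ := {z | z ≠ 0 ∧ |z.arg| < δ}

/-- `S` is a bounded analytic (strongly continuous) semigroup of angle `δ ∈ (0, π/2]` on the complex
normed space `X`.  Only the values of `S` at `0` and on the sector of half-angle `δ` matter. -/
structure IsBoundedAnalyticSemigroup {X : Type*} [NormedAddCommGroup X] [NormedSpace ℂ X]
    (S : ℂ → X →L[ℂ] X) (δ : ℝ) : Prop where
  angle_pos : 0 < δ
  angle_le : δ ≤ Real.pi / 2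
  map_zero : S 0 = ContinuousLinearMap.id ℂ X
  map_add : ∀ z ∈ openSector δ, ∀ w ∈ openSector δ, S (z + w) = (S z).comp (S w)
  analytic : DifferentiableOn ℂ S (openSector δ)
  tendsto_zero : ∀ δ' : ℝ, 0 < δ' → δ' < δ → ∀ x : X,
    Tendsto (fun z => S z x) (𝓝[openSector δ'] 0) (𝓝 x)
  bounded : ∀ δ' : ℝ, 0 < δ' → δ' < δ → ∃ M : ℝ, ∀ z ∈ openSector δ', ‖S z‖ ≤ M

/-- The (unbounded) linear operator `A` is the infinitesimal generator of `S`: `x` belongs to `D(A)`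
and `A x = y` exactly if `(S(t) x - x) / t → y` as `t → 0+`. -/
def IsSemigroupGenerator {X : Type*} [NormedAddCommGroup X] [NormedSpace ℂ X]
    (A : X →ₗ.[ℂ] X) (S : ℂ → X →L[ℂ] X) : Prop :=
  ∀ x y : X, (x, y) ∈ A.graph ↔
    Tendsto (fun t : ℝ => t⁻¹ • (S (t : ℂ) x - x)) (𝓝[>] 0) (𝓝 y)

/-- `A` generates a bounded analytic semigroup, and `S` is that semigroup, `S t = e^{tA}`. -/
def GeneratesBoundedAnalyticSemigroup {X : Type*} [NormedAddCommGroup X] [NormedSpace ℂ X]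
    (A : X →ₗ.[ℂ] X) (S : ℂ → X →L[ℂ] X) : Prop :=
  (∃ δ : ℝ, IsBoundedAnalyticSemigroup S δ) ∧ IsSemigroupGenerator A S

/-- `u ∈ C([0,T];X)` is a mild solution of `u' - A u = f(t,u)`, `u(0) = u₀`, where `S t = e^{tA}`. -/
structure IsMildSolution {X : Type*} [NormedAddCommGroup X] [NormedSpace ℂ X]
    (S : ℂ → X →L[ℂ] X) (f : ℝ → X → X) (T : ℝ) (u₀ : X) (u : ℝ → X) : Prop where
  continuousOn : ContinuousOn u (Icc 0 T)
  integrable : ∀ t ∈ Ioc 0 T, IntervalIntegrable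
    (fun s : ℝ => S ((t - s : ℝ) : ℂ) (f s (u s))) MeasureTheory.volume 0 t
  eq_integral : ∀ t ∈ Ioc 0 T,
    u t = S (t : ℂ) u₀ + ∫ s in (0 : ℝ)..t, S ((t - s : ℝ) : ℂ) (f s (u s))

/-- Local Lipschitz continuity of `f` in its second argument, for times in `[0,T]`: the constant
depends only on a bound for the norms. -/
def IsLocallyLipschitzSource {X : Type*} [NormedAddCommGroup X]
    (f : ℝ → X → X) (T : ℝ) : Prop :=
  ∀ R : ℝ, ∃ L : ℝ, ∀ t ∈ Icc 0 T, ∀ x y : X, ‖x‖ ≤ R → ‖y‖ ≤ R →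
    ‖f t x - f t y‖ ≤ L * ‖x - y‖

/-- The tuples `(m₁, …, m_j)` of positive integers with `m₁ + ⋯ + m_j ≤ ℓ`
(for `j = 0`: the empty tuple). -/
def derivOrders (ℓ j : ℕ) : Finset (Fin j → ℕ) :=
  (Fintype.piFinset fun _ : Fin j => Finset.Icc 1 ℓ).filter fun m => ∑ i, m i ≤ ℓ

/-- `∑_{j=0}^ℓ ∑_{m₁+⋯+m_j ≤ ℓ} ‖v^{(m₁)}(t)‖ ⋯ ‖v^{(m_j)}(t)‖`, derivatives taken within `s`.
The term with `j = 0` is the empty product `1`. -/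
noncomputable def derivProductSum {X : Type*} [NormedAddCommGroup X] [NormedSpace ℝ X]
    (ℓ : ℕ) (v : ℝ → X) (s : Set ℝ) (t : ℝ) : ℝ :=
  ∑ j ∈ Finset.range (ℓ + 1), ∑ m ∈ derivOrders ℓ j, ∏ i, ‖iteratedDerivWithin (m i) v s t‖

/-- Smoothness of `f` in `t` and `u`, for times in `[0,T]`: along every `C^ℓ` curve `v` the function
`t ↦ f(t, v(t))` is `C^ℓ`, and its `ℓ`-th derivative at `t` is controlled by the products of
derivatives of `v`, with a constant depending only on `f`, `ℓ` and a bound for `‖v(t)‖`. -/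
def IsSmoothSource {X : Type*} [NormedAddCommGroup X] [NormedSpace ℝ X]
    (f : ℝ → X → X) (T : ℝ) : Prop :=
  ∀ (ℓ : ℕ) (R : ℝ), ∃ C : ℝ, ∀ a b : ℝ, 0 ≤ a → a < b → b ≤ T →
    ∀ v : ℝ → X, ContDiffOn ℝ ℓ v (Icc a b) →
      ContDiffOn ℝ ℓ (fun t => f t (v t)) (Icc a b) ∧
      ∀ t ∈ Icc a b, ‖v t‖ ≤ R →
        ‖iteratedDerivWithin ℓ (fun t => f t (v t)) (Icc a b) t‖
          ≤ C * derivProductSum ℓ v (Icc a b) t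

/-!
The derivative bounds are obtained on short intervals `(a, b]` by Picard iteration, and the intervals
are then moved along `(0, T]`.

The space of the iteration consists of the functions with `‖g^(ℓ)(t)‖ ≤ B (t - a)^{-ℓ}` on `(a, b]`
for `ℓ ≤ k` (`WeightedDerivBound`).  Three facts make it suitable.  The semigroup itself, started at
`a`, satisfies such bounds by the Cauchy estimates.  The source `f(t, v(t))` satisfies them if `v`
does, because the orders in each product of derivatives add up to at most `ℓ`
(`IsSmoothSource.exists_weightedDerivBound`).  Finally,
`∫_a^t S(t - s) F(s) ds = (t - a) ∫₀¹ S((t - a)(1 - σ)) F(a + (t - a)σ) dσ`, and on the right-hand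
side every derivative in `t` costs exactly one factor `(t - a)⁻¹`, so convolution with the semigroup
preserves the bounds and gains the factor `b - a` (`WeightedDerivBound.convolution`).

Hence for `b - a ≤ τ` all Picard iterates lie in one fixed ball.  No contraction in the weighted norm
is needed: local Lipschitz continuity alone makes the iterates converge uniformly to the mild solution
`u`, and weighted bounds pass to pointwise limits at the cost of two derivatives
(`WeightedDerivBound.of_tendsto`), which is harmless because the order is arbitrary.  The length `τ`
depends only on `k`, `f`, the semigroup and a bound for `‖u‖` on `[0, T]`, so the solution can be
restarted at any time.  For a given `t` the choice `a = max 0 (t - τ/2)` makes `t - a` comparable to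
`t`, which turns the local bound into `C t^{-ℓ}`.
-/

/-! ### Derivatives of all orders as families of functions -/

section WeightedBounds

variable {E F G : Type*} [NormedAddCommGroup E] [NormedSpace ℝ E]
  [NormedAddCommGroup F] [NormedSpace ℝ F] [NormedAddCommGroup G] [NormedSpace ℝ G]

/-- A chain of functions, each the derivative of the one before, consists of the iterated
derivatives of its first member. -/
theorem contDiffOn_of_hasDerivWithinAt_family {s : Set ℝ} (hs : UniqueDiffOn ℝ s) {k : ℕ}
    {g : ℕ → ℝ → E}
    (hd : ∀ j < k, ∀ t ∈ s, HasDerivWithinAt (g j) (g (j + 1) t) s t)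
    (hc : ContinuousOn (g k) s) :
    ContDiffOn ℝ k (g 0) s ∧ ∀ j ≤ k, EqOn (iteratedDerivWithin j (g 0) s) (g j) s := by
  have key : ∀ j ≤ k, EqOn (iteratedDerivWithin j (g 0) s) (g j) s := by
    intro j
    induction j with
    | zero => intro _ t _; simp
    | succ j ih =>
      intro hj t ht
      rw [iteratedDerivWithin_succ, derivWithin_congr (ih (by omega)) (ih (by omega) ht)]
      exact (hd j (by omega) t ht).derivWithin (hs t ht)
  refine ⟨?_, key⟩
  have := contDiffOn_of_continuousOn_differentiableOn_deriv (f := g 0) (s := s) (n := (k : ℕ∞))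
    (𝕜 := ℝ) ?_ ?_
  · exact_mod_cast this
  · intro m hm
    have hm : m ≤ k := by exact_mod_cast hm
    refine ContinuousOn.congr ?_ (key m hm)
    rcases hm.lt_or_eq with h | rfl
    · exact fun t ht => (hd m h t ht).continuousWithinAt
    · exact hc
  · intro m hm
    have hm : m < k := by exact_mod_cast hm
    exact DifferentiableOn.congr (fun t ht => (hd m hm t ht).differentiableWithinAt)
      (key m hm.le)

theorem ContDiffOn.hasDerivWithinAt_iteratedDerivWithin {s : Set ℝ} (hs : UniqueDiffOn ℝ s)
    {k : ℕ} {g : ℝ → E} (hg : ContDiffOn ℝ k g s) {j : ℕ} (hj : j < k) {t : ℝ} (ht : t ∈ s) :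
    HasDerivWithinAt (iteratedDerivWithin j g s) (iteratedDerivWithin (j + 1) g s t) s t := by
  rw [iteratedDerivWithin_succ]
  exact (hg.differentiableOn_iteratedDerivWithin (by exact_mod_cast hj) hs t ht).hasDerivWithinAt

theorem iteratedDerivWithin_eq_of_eventuallyEq_set {s s' : Set ℝ} {t : ℝ} (h : s =ᶠ[𝓝 t] s')
    (n : ℕ) (g : ℝ → E) : iteratedDerivWithin n g s t = iteratedDerivWithin n g s' t := by
  simp only [iteratedDerivWithin, iteratedFDerivWithin_congr_set h n]

/-! ### Weighted derivative bounds -/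

/-- `g` is of class `C^k` on `(a, b]`, and its derivatives of order `ℓ ≤ k` are at most
`B (t - a)^{-ℓ}` there.  The negative power is multiplied out. -/
def WeightedDerivBound (k : ℕ) (a b B : ℝ) (g : ℝ → E) : Prop :=
  ContDiffOn ℝ k g (Ioc a b) ∧
    ∀ ℓ ≤ k, ∀ t ∈ Ioc a b, (t - a) ^ ℓ * ‖iteratedDerivWithin ℓ g (Ioc a b) t‖ ≤ B

namespace WeightedDerivBound

variable {k : ℕ} {a b B B' : ℝ} {g : ℝ → E}

theorem mono (h : WeightedDerivBound k a b B g) (hB : B ≤ B') : WeightedDerivBound k a b B' g :=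
  ⟨h.1, fun ℓ hℓ t ht => (h.2 ℓ hℓ t ht).trans hB⟩

theorem congr {g' : ℝ → E} (h : WeightedDerivBound k a b B g) (hg : EqOn g' g (Ioc a b)) :
    WeightedDerivBound k a b B g' :=
  ⟨h.1.congr hg, fun ℓ hℓ t ht => by rw [iteratedDerivWithin_congr hg ht]; exact h.2 ℓ hℓ t ht⟩

theorem norm_le (h : WeightedDerivBound k a b B g) {t : ℝ} (ht : t ∈ Ioc a b) : ‖g t‖ ≤ B := by
  simpa using h.2 0 (Nat.zero_le k) t ht

/-- It suffices to bound candidates for the derivatives, given as a chain of functions. -/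
theorem of_family {g : ℕ → ℝ → E}
    (hd : ∀ j < k, ∀ t ∈ Ioc a b, HasDerivWithinAt (g j) (g (j + 1) t) (Ioc a b) t)
    (hc : ContinuousOn (g k) (Ioc a b))
    (hB : ∀ j ≤ k, ∀ t ∈ Ioc a b, (t - a) ^ j * ‖g j t‖ ≤ B) :
    WeightedDerivBound k a b B (g 0) := by
  obtain ⟨h1, h2⟩ := contDiffOn_of_hasDerivWithinAt_family (uniqueDiffOn_Ioc a b) hd hc
  exact ⟨h1, fun ℓ hℓ t ht => by rw [h2 ℓ hℓ ht]; exact hB ℓ hℓ t ht⟩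

theorem add {g' : ℝ → E} (h : WeightedDerivBound k a b B g)
    (h' : WeightedDerivBound k a b B' g') :
    WeightedDerivBound k a b (B + B') (fun t => g t + g' t) := by
  refine ⟨h.1.add h'.1, fun ℓ hℓ t ht => ?_⟩
  have hℓ' : (ℓ : WithTop ℕ∞) ≤ k := by exact_mod_cast hℓ
  rw [iteratedDerivWithin_fun_add ht (uniqueDiffOn_Ioc a b) ((h.1 t ht).of_le hℓ')
    ((h'.1 t ht).of_le hℓ')]
  have h0 : 0 ≤ (t - a) ^ ℓ := pow_nonneg (by linarith [ht.1]) _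
  calc _ ≤ (t - a) ^ ℓ * (‖iteratedDerivWithin ℓ g (Ioc a b) t‖
        + ‖iteratedDerivWithin ℓ g' (Ioc a b) t‖) :=
        mul_le_mul_of_nonneg_left (norm_add_le _ _) h0
    _ ≤ B + B' := by rw [mul_add]; exact add_le_add (h.2 ℓ hℓ t ht) (h'.2 ℓ hℓ t ht)

theorem const {c : E} (hB : ‖c‖ ≤ B) : WeightedDerivBound k a b B (fun _ => c) := by
  refine ⟨contDiffOn_const, fun ℓ _ t _ => ?_⟩
  rw [iteratedDerivWithin_const]
  split_ifs with h
  · simpa [h] using hB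
  · simpa using (norm_nonneg c).trans hB

/-- Leibniz rule: the weights multiply, so no power of `t - a` is lost. -/
theorem bilinear (L : E →L[ℝ] F →L[ℝ] G) (hL : ‖L‖ ≤ 1) {g' : ℝ → F}
    (h : WeightedDerivBound k a b B g) (h' : WeightedDerivBound k a b B' g')
    (hB : 0 ≤ B) (hB' : 0 ≤ B') :
    WeightedDerivBound k a b (2 ^ k * B * B') (fun t => L (g t) (g' t)) := by
  refine ⟨(L.isBoundedBilinearMap.contDiff.comp_contDiffOn (h.1.prodMk h'.1)), ?_⟩
  intro ℓ hℓ t ht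
  have h0 : 0 ≤ t - a := by linarith [ht.1]
  have key := L.norm_iteratedFDerivWithin_le_of_bilinear_of_le_one h.1 h'.1
    (uniqueDiffOn_Ioc a b) ht (n := ℓ) (by exact_mod_cast hℓ) hL
  simp only [norm_iteratedFDerivWithin_eq_norm_iteratedDerivWithin] at key
  calc _ ≤ (t - a) ^ ℓ * ∑ i ∈ Finset.range (ℓ + 1), (ℓ.choose i : ℝ)
          * ‖iteratedDerivWithin i g (Ioc a b) t‖
          * ‖iteratedDerivWithin (ℓ - i) g' (Ioc a b) t‖ :=
        mul_le_mul_of_nonneg_left key (pow_nonneg h0 _)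
    _ ≤ ∑ i ∈ Finset.range (ℓ + 1), (ℓ.choose i : ℝ) * (B * B') := by
        rw [Finset.mul_sum]
        refine Finset.sum_le_sum fun i hi => ?_
        have hi : i ≤ ℓ := by simpa [Nat.lt_succ_iff] using hi
        have e : (t - a) ^ ℓ = (t - a) ^ i * (t - a) ^ (ℓ - i) := by
          rw [← pow_add]; congr 1; omega
        have := mul_le_mul (h.2 i (hi.trans hℓ) t ht) (h'.2 (ℓ - i) (by omega) t ht)
          (by positivity) hB
        calc _ = (ℓ.choose i : ℝ) * (((t - a) ^ i * ‖iteratedDerivWithin i g (Ioc a b) t‖)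
              * ((t - a) ^ (ℓ - i) * ‖iteratedDerivWithin (ℓ - i) g' (Ioc a b) t‖)) := by
              rw [e]; ring
          _ ≤ _ := by gcongr
    _ = 2 ^ ℓ * (B * B') := by
        rw [← Finset.sum_mul]; congr 1; exact_mod_cast Nat.sum_range_choose ℓ
    _ ≤ 2 ^ k * B * B' := by
        rw [mul_assoc]
        exact mul_le_mul_of_nonneg_right (pow_le_pow_right₀ (by norm_num) hℓ) (by positivity)

/-- Contracting the time variable towards `a` preserves the weighted bounds: the factor `σ ^ ℓ`
from the chain rule pays for evaluating the weight at the contracted time. -/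
theorem comp_contraction (h : WeightedDerivBound k a b B g) {σ : ℝ} (h0 : 0 < σ) (h1 : σ ≤ 1) :
    WeightedDerivBound k a b B (fun t => g (a + (t - a) * σ)) := by
  have hm : MapsTo (fun t => a + (t - a) * σ) (Ioc a b) (Ioc a b) := by
    intro t ht
    have := sub_pos.2 ht.1
    refine ⟨?_, ?_⟩
    · have := mul_pos this h0; dsimp; linarith
    · have := mul_le_of_le_one_right this.le h1; dsimp; linarith [ht.2]
  have hm' : ContinuousOn (fun t => a + (t - a) * σ) (Ioc a b) := by fun_prop
  have key := of_family (k := k) (a := a) (b := b) (B := B) (g := fun j t =>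
    σ ^ j • iteratedDerivWithin j g (Ioc a b) (a + (t - a) * σ)) ?_ ?_ ?_
  · simpa using key
  · intro j hj t ht
    have e1 : HasDerivWithinAt (fun t => a + (t - a) * σ) σ (Ioc a b) t := by
      simpa using (((hasDerivWithinAt_id t (Ioc a b)).sub_const a).mul_const σ).const_add a
    have e2 := (h.1.hasDerivWithinAt_iteratedDerivWithin (uniqueDiffOn_Ioc a b) hj (hm ht)).scomp
      t e1 hm
    have e3 := e2.const_smul (σ ^ j)
    rw [smul_smul, ← pow_succ] at e3
    exact e3
  · exact ((h.1.continuousOn_iteratedDerivWithin le_rfl (uniqueDiffOn_Ioc a b)).comp hm'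
      hm).const_smul _
  · intro j hj t ht
    have := h.2 j hj _ (hm ht)
    rw [norm_smul, Real.norm_of_nonneg (by positivity)]
    calc _ = (a + (t - a) * σ - a) ^ j
          * ‖iteratedDerivWithin j g (Ioc a b) (a + (t - a) * σ)‖ := by
            rw [add_sub_cancel_left, mul_pow, mul_assoc]
      _ ≤ B := this

theorem sub_left (hab : a ≤ b) : WeightedDerivBound k a b (b - a) (fun t => t - a) := by
  have key := of_family (k := k) (a := a) (b := b) (B := b - a) (g := fun j t =>
    if j = 0 then t - a else if j = 1 then (1 : ℝ) else 0) ?_ ?_ ?_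
  · simpa using key
  · intro j hj t ht
    rcases j with _ | _ | j
    · simpa using (hasDerivWithinAt_id t (Ioc a b)).sub_const a
    · simpa using hasDerivWithinAt_const t (Ioc a b) (1 : ℝ)
    · simpa using hasDerivWithinAt_const t (Ioc a b) (0 : ℝ)
  · rcases k with _ | _ | k <;> simp <;> fun_prop
  · intro j hj t ht
    have := sub_pos.2 ht.1
    rcases j with _ | _ | j
    · simp [abs_of_pos this, ht.2]
    · simp [ht.2]
    · simpa using hab

/-- Differentiation under the integral sign within `(a, b]`, including the end point `b`, by dominated
convergence of the slopes.  Measurability of the derivative in the parameter is part of the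
conclusion, since it is a limit of a sequence of slopes. -/
theorem hasDerivWithinAt_integral {Ω : Type*} [MeasurableSpace Ω] {μ : MeasureTheory.Measure Ω}
    [MeasureTheory.IsFiniteMeasure μ] {p q : Ω → ℝ → E} {t : ℝ} (ht : t ∈ Ioc a b) {c C : ℝ}
    (hc : c ∈ Ioo a t)
    (hp : ∀ x ∈ Ioc a b, MeasureTheory.AEStronglyMeasurable (fun σ => p σ x) μ)
    (hd : ∀ᵐ σ ∂μ, ∀ x ∈ Ioc a b, HasDerivWithinAt (p σ) (q σ x) (Ioc a b) x)
    (hC : ∀ᵐ σ ∂μ, ∀ x ∈ Ioc c b, ‖q σ x‖ ≤ C)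
    (hi : ∀ x ∈ Ioc a b, MeasureTheory.Integrable (fun σ => p σ x) μ) :
    MeasureTheory.AEStronglyMeasurable (fun σ => q σ t) μ ∧
      HasDerivWithinAt (fun x => ∫ σ, p σ x ∂μ) (∫ σ, q σ t ∂μ) (Ioc a b) t := by
  have hslope : ∀ x ∈ Ioc a b,
      MeasureTheory.AEStronglyMeasurable (fun σ => slope (p σ) t x) μ := by
    intro x hx
    simp only [slope_def_module]
    exact ((hp x hx).sub (hp t ht)).const_smul _
  have hlim : ∀ᵐ σ ∂μ, Tendsto (fun x => slope (p σ) t x) (𝓝[Ioc a b \ {t}] t) (𝓝 (q σ t)) := by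
    filter_upwards [hd] with σ hσ
    exact hasDerivWithinAt_iff_tendsto_slope.1 (hσ t ht)
  have hmem : ∀ᶠ x in 𝓝[Ioc a b \ {t}] t, x ∈ Ioc c b \ {t} := by
    have h1 : ∀ᶠ x in 𝓝[Ioc a b \ {t}] t, x ∈ Ioi c :=
      mem_nhdsWithin_of_mem_nhds (Ioi_mem_nhds hc.2)
    filter_upwards [h1, self_mem_nhdsWithin] with x hx hx'
    exact ⟨⟨hx, hx'.1.2⟩, hx'.2⟩
  have hsub : Ioc c b ⊆ Ioc a b := Ioc_subset_Ioc_left hc.1.le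
  have hne : (𝓝[Ioc a b \ {t}] t).NeBot :=
    accPt_principal_iff_nhdsWithin.1 (uniqueDiffWithinAt_iff_accPt.1 (uniqueDiffOn_Ioc a b t ht))
  refine ⟨?_, ?_⟩
  · obtain ⟨x, hx⟩ := exists_seq_tendsto (𝓝[Ioc a b \ {t}] t)
    obtain ⟨N, hN⟩ := eventually_atTop.1 (hx.eventually hmem)
    refine aestronglyMeasurable_of_tendsto_ae atTop (f := fun n σ => slope (p σ) t (x (n + N)))
      (fun n => hslope _ (hsub (hN (n + N) (by omega)).1)) ?_
    filter_upwards [hlim] with σ hσ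
    exact hσ.comp (hx.comp (tendsto_add_atTop_nat N))
  · rw [hasDerivWithinAt_iff_tendsto_slope]
    have key := MeasureTheory.tendsto_integral_filter_of_dominated_convergence (μ := μ)
      (l := 𝓝[Ioc a b \ {t}] t) (F := fun x σ => slope (p σ) t x) (f := fun σ => q σ t)
      (fun _ => C) ?_ ?_ (MeasureTheory.integrable_const C) hlim
    · refine key.congr' ?_
      filter_upwards [hmem] with x hx
      simp only [slope_def_module]
      rw [MeasureTheory.integral_smul, MeasureTheory.integral_sub (hi x (hsub hx.1)) (hi t ht)]
    · filter_upwards [hmem] with x hx using hslope x (hsub hx.1)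
    · filter_upwards [hmem] with x hx
      filter_upwards [hd, hC] with σ hσ hσC
      have := (convex_Ioc c b).norm_image_sub_le_of_norm_hasDerivWithin_le
        (fun y hy => (hσ y (hsub hy)).mono hsub) hσC (x := t) (y := x) ⟨hc.2, ht.2⟩ hx.1
      rw [slope_def_module, norm_smul, norm_inv, inv_mul_le_iff₀ (norm_pos_iff.2 (sub_ne_zero.2 hx.2))]
      linarith

/-- Averaging over a parameter preserves the weighted bounds. -/
theorem integral {Ω : Type*} [MeasurableSpace Ω] {μ : MeasureTheory.Measure Ω}
    [MeasureTheory.IsProbabilityMeasure μ] {φ : Ω → ℝ → E}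
    (hm : ∀ x ∈ Ioc a b, MeasureTheory.AEStronglyMeasurable (fun σ => φ σ x) μ)
    (hφ : ∀ᵐ σ ∂μ, WeightedDerivBound k a b B (φ σ)) :
    WeightedDerivBound k a b B (fun t => ∫ σ, φ σ t ∂μ) := by
  set D : ℕ → Ω → ℝ → E := fun j σ t => iteratedDerivWithin j (φ σ) (Ioc a b) t with hD
  have hloc : ∀ j ≤ k, ∀ c > a, ∀ᵐ σ ∂μ, ∀ x ∈ Ioc c b, ‖D j σ x‖ ≤ B / (c - a) ^ j := by
    intro j hj c hc
    filter_upwards [hφ] with σ hσ x hx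
    have hx' : x ∈ Ioc a b := ⟨hc.trans hx.1, hx.2⟩
    have h1 := hσ.2 j hj x hx'
    have h2 : 0 < c - a := sub_pos.2 hc
    rw [le_div_iff₀ (by positivity), mul_comm]
    refine le_trans (mul_le_mul_of_nonneg_right ?_ (norm_nonneg _)) h1
    exact pow_le_pow_left₀ h2.le (by linarith [hx.1]) j
  have hmid : ∀ t ∈ Ioc a b, (a + t) / 2 ∈ Ioo a t := fun t ht =>
    ⟨by linarith [ht.1], by linarith [ht.1]⟩
  have hderiv : ∀ j < k, ∀ᵐ σ ∂μ, ∀ x ∈ Ioc a b,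
      HasDerivWithinAt (D j σ) (D (j + 1) σ x) (Ioc a b) x := by
    intro j hj
    filter_upwards [hφ] with σ hσ x hx
    exact hσ.1.hasDerivWithinAt_iteratedDerivWithin (uniqueDiffOn_Ioc a b) hj hx
  have hint : ∀ j ≤ k, ∀ x ∈ Ioc a b, MeasureTheory.AEStronglyMeasurable (fun σ => D j σ x) μ →
      MeasureTheory.Integrable (fun σ => D j σ x) μ := by
    intro j hj x hx hmx
    refine MeasureTheory.Integrable.of_bound hmx (B / ((a + x) / 2 - a) ^ j) ?_
    filter_upwards [hloc j hj _ (hmid x hx).1] with σ hσ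
    exact hσ x ⟨(hmid x hx).2, hx.2⟩
  have hmeas : ∀ j ≤ k, ∀ x ∈ Ioc a b,
      MeasureTheory.AEStronglyMeasurable (fun σ => D j σ x) μ := by
    intro j
    induction j with
    | zero => intro _ x hx; simpa [hD] using hm x hx
    | succ j ih =>
      intro hj x hx
      exact (hasDerivWithinAt_integral hx (hmid x hx) (ih (by omega)) (hderiv j hj)
        (hloc (j + 1) hj _ (hmid x hx).1)
        (fun y hy => hint j (by omega) y hy (ih (by omega) y hy))).1
  have key := of_family (k := k) (a := a) (b := b) (B := B) (g := fun j t => ∫ σ, D j σ t ∂μ)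
    ?_ ?_ ?_
  · simpa [hD] using key
  · intro j hj t ht
    exact (hasDerivWithinAt_integral ht (hmid t ht) (hmeas j hj.le) (hderiv j hj)
        (hloc (j + 1) hj _ (hmid t ht).1)
        (fun y hy => hint j hj.le y hy (hmeas j hj.le y hy))).2
  · intro t ht
    refine MeasureTheory.continuousWithinAt_of_dominated
      (bound := fun _ => B / ((a + t) / 2 - a) ^ k) ?_ ?_ (MeasureTheory.integrable_const _) ?_
    · filter_upwards [self_mem_nhdsWithin] with x hx using hmeas k le_rfl x hx
    · have h1 : ∀ᶠ x in 𝓝[Ioc a b] t, x ∈ Ioi ((a + t) / 2) :=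
        mem_nhdsWithin_of_mem_nhds (Ioi_mem_nhds (hmid t ht).2)
      filter_upwards [h1, self_mem_nhdsWithin] with x hx hx'
      filter_upwards [hloc k le_rfl _ (hmid t ht).1] with σ hσ
      exact hσ x ⟨hx, hx'.2⟩
    · filter_upwards [hφ] with σ hσ
      exact hσ.1.continuousOn_iteratedDerivWithin le_rfl (uniqueDiffOn_Ioc a b) t ht
  · intro j hj t ht
    have h0 : 0 ≤ (t - a) ^ j := pow_nonneg (by linarith [ht.1]) _
    have := MeasureTheory.norm_integral_le_of_norm_le_const (μ := μ)
      (f := fun σ => (t - a) ^ j • D j σ t) (C := B) (by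
        filter_upwards [hφ] with σ hσ
        rw [norm_smul, Real.norm_of_nonneg h0]
        exact hσ.2 j hj t ht)
    rw [MeasureTheory.integral_smul, norm_smul, Real.norm_of_nonneg h0] at this
    simpa using this

end WeightedDerivBound

/-! ### Pointwise limits -/

/-- Second order Taylor estimate; the bound on the second derivative is needed only between the two
points. -/
theorem norm_sub_sub_smul_le {s : Set ℝ} {w w' w'' : ℝ → E} {x t B : ℝ} (hs : uIcc t x ⊆ s)
    (h1 : ∀ y ∈ s, HasDerivWithinAt w (w' y) s y)
    (h2 : ∀ y ∈ s, HasDerivWithinAt w' (w'' y) s y)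
    (hB : ∀ y ∈ uIcc t x, ‖w'' y‖ ≤ B) :
    ‖w x - w t - (x - t) • w' t‖ ≤ B * |x - t| ^ 2 := by
  have hB0 : 0 ≤ B := (norm_nonneg _).trans (hB t left_mem_uIcc)
  have e1 : ∀ y ∈ uIcc t x, ‖w' y - w' t‖ ≤ B * |x - t| := fun y hy => by
    refine ((convex_uIcc t x).norm_image_sub_le_of_norm_hasDerivWithin_le
      (fun z hz => (h2 z (hs hz)).mono hs) hB left_mem_uIcc hy).trans ?_
    exact mul_le_mul_of_nonneg_left (abs_sub_left_of_mem_uIcc hy) hB0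
  have e2 := (convex_uIcc t x).norm_image_sub_le_of_norm_hasDerivWithin_le
    (f := fun y => w y - (y - t) • w' t) (f' := fun y => w' y - w' t) (C := B * |x - t|)
    (fun z hz => by
      have := ((h1 z (hs hz)).mono hs).sub
        (((hasDerivWithinAt_id z (uIcc t x)).sub_const t).smul_const (w' t))
      rw [one_smul] at this
      exact this) e1 left_mem_uIcc right_mem_uIcc
  calc _ = ‖w x - (x - t) • w' t - (w t - (t - t) • w' t)‖ := by
        congr 1; simp only [sub_self, zero_smul]; abel
    _ ≤ B * |x - t| * ‖x - t‖ := e2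
    _ = _ := by rw [Real.norm_eq_abs]; ring

/-- Differentiation passes to pointwise limits when second derivatives are locally bounded uniformly
along the sequence: the Taylor estimate is stable under pointwise limits, and it makes the
first derivatives Cauchy. -/
theorem exists_tendsto_and_hasDerivWithinAt [CompleteSpace E] {a b : ℝ} {w w' w'' : ℕ → ℝ → E}
    (h1 : ∀ n, ∀ y ∈ Ioc a b, HasDerivWithinAt (w n) (w' n y) (Ioc a b) y)
    (h2 : ∀ n, ∀ y ∈ Ioc a b, HasDerivWithinAt (w' n) (w'' n y) (Ioc a b) y)
    (hB : ∀ c > a, ∃ C, ∀ n, ∀ y ∈ Ioc c b, ‖w'' n y‖ ≤ C) {z : ℝ → E}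
    (hz : ∀ y ∈ Ioc a b, Tendsto (fun n => w n y) atTop (𝓝 (z y))) {t : ℝ} (ht : t ∈ Ioc a b) :
    ∃ z', Tendsto (fun n => w' n t) atTop (𝓝 z') ∧ HasDerivWithinAt z z' (Ioc a b) t := by
  obtain ⟨c, hac, hct⟩ : ∃ c, a < c ∧ c < t := exists_between ht.1
  obtain ⟨C, hC⟩ := hB c hac
  have hC0 : 0 ≤ C := (norm_nonneg _).trans (hC 0 t ⟨hct, ht.2⟩)
  have hsub : Ioc c b ⊆ Ioc a b := Ioc_subset_Ioc_left hac.le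
  have taylor : ∀ n, ∀ x ∈ Ioc c b,
      ‖w n x - w n t - (x - t) • w' n t‖ ≤ C * |x - t| ^ 2 := by
    intro n x hx
    have hux : uIcc t x ⊆ Ioc c b := ordConnected_Ioc.uIcc_subset ⟨hct, ht.2⟩ hx
    exact norm_sub_sub_smul_le (hux.trans hsub) (h1 n) (h2 n) fun y hy => hC n y (hux hy)
  have hcau : CauchySeq (fun n => w' n t) := by
    rw [Metric.cauchySeq_iff']
    intro ε hε
    -- a difference quotient of step `δ` approximates the derivative up to `C * δ`, for every `n`
    obtain ⟨δ, hδ, hδ'⟩ : ∃ δ, 0 < δ ∧ δ < min (t - c) (ε / (4 * (C + 1))) :=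
      exists_between (lt_min (sub_pos.2 hct) (by positivity))
    have hx : t - δ ∈ Ioc c b := by
      have := (lt_min_iff.1 hδ').1
      exact ⟨by linarith, by linarith [ht.2]⟩
    have hCδ : 4 * (C * δ) ≤ ε := by
      have := (lt_min_iff.1 hδ').2
      rw [lt_div_iff₀ (by positivity)] at this
      nlinarith
    have hd : CauchySeq (fun n => w n (t - δ) - w n t) :=
      ((hz _ (hsub hx)).sub (hz t ht)).cauchySeq
    obtain ⟨N, hN⟩ := Metric.cauchySeq_iff'.1 hd (δ * (ε / 4)) (by positivity)
    refine ⟨N, fun n hn => ?_⟩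
    have hN := hN n hn
    have t1 := taylor n _ hx
    have t2 := taylor N _ hx
    rw [dist_eq_norm] at hN ⊢
    have e : t - δ - t = -δ := by ring
    rw [e, abs_neg, abs_of_pos hδ] at t1 t2
    have h3 : ‖δ • (w' n t - w' N t)‖ ≤ C * δ ^ 2 + C * δ ^ 2 + δ * (ε / 4) := by
      calc _ = ‖(w n (t - δ) - w n t - -δ • w' n t) - (w N (t - δ) - w N t - -δ • w' N t)
            - (w n (t - δ) - w n t - (w N (t - δ) - w N t))‖ := by
            congr 1; module
        _ ≤ _ := (norm_sub_le _ _).trans (add_le_add ((norm_sub_le _ _).trans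
            (add_le_add t1 t2)) hN.le)
    rw [norm_smul, Real.norm_of_nonneg hδ.le] at h3
    have h4 : δ * ‖w' n t - w' N t‖ < δ * ε := by nlinarith [mul_pos hδ hε]
    exact lt_of_mul_lt_mul_left h4 hδ.le
  obtain ⟨z', hz'⟩ := cauchySeq_tendsto_of_complete hcau
  refine ⟨z', hz', ?_⟩
  rw [hasDerivWithinAt_iff_isLittleO]
  refine Asymptotics.IsBigO.trans_isLittleO (g := fun x => ‖x - t‖ ^ 2) ?_
    ((Asymptotics.isLittleO_pow_sub_sub t one_lt_two).mono nhdsWithin_le_nhds)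
  refine Asymptotics.IsBigO.of_bound C ?_
  have hm : ∀ᶠ x in 𝓝[Ioc a b] t, x ∈ Ioi c :=
    mem_nhdsWithin_of_mem_nhds (Ioi_mem_nhds hct)
  filter_upwards [hm, self_mem_nhdsWithin] with x hx hx'
  have := le_of_tendsto ((((hz x hx').sub (hz t ht)).sub (hz'.const_smul (x - t))).norm)
    (Eventually.of_forall fun n => taylor n x ⟨hx, hx'.2⟩)
  simpa [norm_pow] using this

/-- Weighted bounds pass to pointwise limits, at the cost of two orders of differentiability. -/
theorem WeightedDerivBound.of_tendsto [CompleteSpace E] {k : ℕ} {a b B : ℝ} {v : ℕ → ℝ → E}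
    {u : ℝ → E} (hv : ∀ n, WeightedDerivBound (k + 2) a b B (v n))
    (hu : ∀ t ∈ Ioc a b, Tendsto (fun n => v n t) atTop (𝓝 (u t))) :
    WeightedDerivBound k a b B u := by
  set D : ℕ → ℕ → ℝ → E := fun j n => iteratedDerivWithin j (v n) (Ioc a b) with hD
  set z : ℕ → ℝ → E := fun j t => limUnder atTop (fun n => D j n t) with hz
  have hd : ∀ j < k + 2, ∀ n, ∀ y ∈ Ioc a b,
      HasDerivWithinAt (D j n) (D (j + 1) n y) (Ioc a b) y := fun j hj n y hy =>
    (hv n).1.hasDerivWithinAt_iteratedDerivWithin (uniqueDiffOn_Ioc a b) hj hy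
  have hloc : ∀ j ≤ k + 2, ∀ c > a, ∃ C, ∀ n, ∀ y ∈ Ioc c b, ‖D j n y‖ ≤ C := by
    intro j hj c hc
    refine ⟨B / (c - a) ^ j, fun n y hy => ?_⟩
    have h2 : 0 < c - a := sub_pos.2 hc
    rw [le_div_iff₀ (by positivity), mul_comm]
    refine le_trans (mul_le_mul_of_nonneg_right ?_ (norm_nonneg _))
      ((hv n).2 j hj y ⟨hc.trans hy.1, hy.2⟩)
    exact pow_le_pow_left₀ h2.le (by linarith [hy.1]) j
  have hlim : ∀ j ≤ k + 1, ∀ t ∈ Ioc a b, Tendsto (fun n => D j n t) atTop (𝓝 (z j t)) := by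
    intro j
    induction j with
    | zero =>
      intro _ t ht
      exact tendsto_nhds_limUnder ⟨u t, by simpa [hD] using hu t ht⟩
    | succ j ih =>
      intro hj t ht
      obtain ⟨z', h, -⟩ := exists_tendsto_and_hasDerivWithinAt (hd j (by omega))
        (hd (j + 1) (by omega)) (hloc (j + 2) (by omega)) (ih (by omega)) ht
      exact tendsto_nhds_limUnder ⟨z', h⟩
  have hderiv : ∀ j ≤ k, ∀ t ∈ Ioc a b, HasDerivWithinAt (z j) (z (j + 1) t) (Ioc a b) t := by
    intro j hj t ht
    obtain ⟨z', h, h'⟩ := exists_tendsto_and_hasDerivWithinAt (hd j (by omega))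
        (hd (j + 1) (by omega)) (hloc (j + 2) (by omega)) (hlim j (by omega)) ht
    rwa [tendsto_nhds_unique (hlim (j + 1) (by omega) t ht) h]
  have key := WeightedDerivBound.of_family (k := k) (B := B) (fun j hj => hderiv j hj.le)
    (fun t ht => (hderiv k le_rfl t ht).continuousWithinAt) (fun j hj t ht =>
      le_of_tendsto ((hlim j (by omega) t ht).norm.const_mul _)
        (Eventually.of_forall fun n => (hv n).2 j (by omega) t ht))
  refine key.congr fun t ht => ?_
  exact tendsto_nhds_unique (hu t ht) (by simpa [hD] using hlim 0 (by omega) t ht)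

end WeightedBounds

/-! ### Analytic semigroups and convolution -/

section Semigroup

variable {X : Type*} [NormedAddCommGroup X] [NormedSpace ℂ X] {S : ℂ → X →L[ℂ] X} {δ : ℝ}

/-- Some disc around `1`, and by homogeneity every dilate of it, is contained in a given sector. -/
theorem exists_closedBall_subset_openSector (hδ : 0 < δ) :
    ∃ r > 0, ∀ t : ℝ, 0 < t → Metric.closedBall (t : ℂ) (r * t) ⊆ openSector δ := by
  have h1 : openSector δ ∈ 𝓝 (1 : ℂ) := by
    have hc : ContinuousAt (fun z : ℂ => |z.arg|) 1 :=
      (Complex.continuousAt_arg Complex.one_mem_slitPlane).abs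
    exact inter_mem (isOpen_ne.mem_nhds one_ne_zero)
      (hc.eventually (gt_mem_nhds (by simpa using hδ)))
  obtain ⟨r, hr, hrs⟩ := Metric.nhds_basis_closedBall.mem_iff.1 h1
  refine ⟨r, hr, fun t ht z hz => ?_⟩
  have ht' : (t : ℂ) ≠ 0 := by exact_mod_cast ht.ne'
  have hz' : z / t ∈ openSector δ := by
    refine hrs ?_
    rw [Metric.mem_closedBall, dist_eq_norm] at hz ⊢
    have : z / t - 1 = (z - t) / t := by field_simp
    rw [this, norm_div, Complex.norm_real, Real.norm_of_nonneg ht.le, div_le_iff₀ ht]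
    exact hz
  have e : z = (t : ℂ) * (z / t) := by field_simp
  rw [e]
  exact ⟨mul_ne_zero ht' hz'.1, by rw [Complex.arg_real_mul _ ht]; exact hz'.2⟩

theorem openSector_mono {δ' : ℝ} (h : δ' ≤ δ) : openSector δ' ⊆ openSector δ :=
  fun _ hz => ⟨hz.1, hz.2.trans_le h⟩

theorem ofReal_mem_openSector (hδ : 0 < δ) {t : ℝ} (ht : 0 < t) : (t : ℂ) ∈ openSector δ :=
  ⟨by exact_mod_cast ht.ne', by rwa [Complex.arg_ofReal_of_nonneg ht.le, abs_zero]⟩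

/-- The `n`-th derivative of a bounded analytic semigroup at time `t > 0` is of size `t^{-n}`, by the
Cauchy estimates on a disc of radius proportional to `t`. -/
theorem IsBoundedAnalyticSemigroup.exists_weightedDerivBound [CompleteSpace X]
    (hS : IsBoundedAnalyticSemigroup S δ) (k : ℕ) :
    ∃ C ≥ 1, ∀ a b : ℝ, WeightedDerivBound k a b C (fun t => S ((t - a : ℝ) : ℂ)) := by
  have hδ := hS.angle_pos
  obtain ⟨M, hM⟩ := hS.bounded (δ / 2) (by linarith) (by linarith)
  obtain ⟨r, hr, hball⟩ := exists_closedBall_subset_openSector (δ := δ / 2) (by linarith)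
  have hM0 : 0 ≤ M := (norm_nonneg _).trans
    (hM _ (ofReal_mem_openSector (by linarith) one_pos))
  have hball' : ∀ t : ℝ, 0 < t → Metric.closedBall (t : ℂ) (r * t) ⊆ openSector δ :=
    fun t ht => (hball t ht).trans (openSector_mono (by linarith))
  have cauchy : ∀ (n : ℕ) (t : ℝ), 0 < t →
      t ^ n * ‖iteratedDeriv n S (t : ℂ)‖ ≤ n.factorial * M / r ^ n := by
    intro n t ht
    have := Complex.norm_iteratedDeriv_le_of_forall_mem_sphere_norm_le (C := M) n
      (mul_pos hr ht) (hS.analytic.diffContOnCl_ball (hball' t ht))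
      (fun z hz => hM z (hball t ht (Metric.sphere_subset_closedBall hz)))
    rw [mul_pow, ← div_div, le_div_iff₀ (by positivity)] at this
    linarith
  have hderiv : ∀ (j : ℕ) (t : ℝ), 0 < t →
      HasDerivAt (iteratedDeriv j S) (iteratedDeriv (j + 1) S t) (t : ℂ) := by
    intro j t ht
    have hn : openSector δ ∈ 𝓝 (t : ℂ) :=
      mem_of_superset (Metric.closedBall_mem_nhds _ (mul_pos hr ht)) (hball' t ht)
    have := (hS.analytic.analyticAt hn).iterated_deriv j
    rw [← iteratedDeriv_eq_iterate] at this
    rw [iteratedDeriv_succ]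
    exact this.differentiableAt.hasDerivAt
  have hnn : ∀ j : ℕ, 0 ≤ (j.factorial : ℝ) * M / r ^ j := fun j => by positivity
  refine ⟨1 + ∑ j ∈ Finset.range (k + 1), (j.factorial : ℝ) * M / r ^ j,
    le_add_of_nonneg_right (Finset.sum_nonneg fun j _ => hnn j), fun a b => ?_⟩
  have hd : ∀ (j : ℕ), ∀ t ∈ Ioc a b, HasDerivWithinAt
      (fun t : ℝ => iteratedDeriv j S ((t - a : ℝ) : ℂ))
      (iteratedDeriv (j + 1) S ((t - a : ℝ) : ℂ)) (Ioc a b) t := by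
    intro j t ht
    have e1 : HasDerivAt (fun t : ℝ => ((t - a : ℝ) : ℂ)) 1 t := by
      simpa using ((hasDerivAt_id t).sub_const a).ofReal_comp
    have e2 := HasDerivAt.scomp t (hderiv j (t - a) (sub_pos.2 ht.1)) e1
    rw [one_smul] at e2
    exact e2.hasDerivWithinAt
  have key := WeightedDerivBound.of_family (k := k) (a := a) (b := b)
    (g := fun (j : ℕ) (t : ℝ) => iteratedDeriv j S ((t - a : ℝ) : ℂ)) (fun j _ => hd j)
    (fun t ht => (hd k t ht).continuousWithinAt) (fun j hj t ht =>
      (cauchy j _ (sub_pos.2 ht.1)).trans (le_add_of_nonneg_of_le zero_le_one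
        (Finset.single_le_sum (f := fun j : ℕ => (j.factorial : ℝ) * M / r ^ j)
          (fun j _ => hnn j) (Finset.mem_range.2 (Nat.lt_succ_of_le hj)))))
  simpa using key

theorem IsBoundedAnalyticSemigroup.norm_le_of_nonneg (hS : IsBoundedAnalyticSemigroup S δ) {C : ℝ}
    {k : ℕ} (hC : 1 ≤ C)
    (hSC : ∀ a b : ℝ, WeightedDerivBound k a b C (fun t => S ((t - a : ℝ) : ℂ)))
    {t : ℝ} (ht : 0 ≤ t) : ‖S (t : ℂ)‖ ≤ C := by
  rcases ht.eq_or_lt with rfl | ht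
  · rw [Complex.ofReal_zero, hS.map_zero]
    exact ContinuousLinearMap.norm_id_le.trans hC
  · simpa using (hSC 0 t).norm_le (t := t) ⟨ht, le_rfl⟩

theorem norm_restrictScalarsL_real_le_one :
    ‖ContinuousLinearMap.restrictScalarsL ℂ X X ℝ ℝ‖ ≤ 1 :=
  ContinuousLinearMap.opNorm_le_bound _ zero_le_one fun A => by simp

theorem WeightedDerivBound.clm_apply {k : ℕ} {a b B B' : ℝ} {G : ℝ → X →L[ℂ] X} {F : ℝ → X}
    (h : WeightedDerivBound k a b B G) (h' : WeightedDerivBound k a b B' F) (hB : 0 ≤ B)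
    (hB' : 0 ≤ B') : WeightedDerivBound k a b (2 ^ k * B * B') (fun t => G t (F t)) :=
  h.bilinear (ContinuousLinearMap.restrictScalarsL ℂ X X ℝ ℝ)
    norm_restrictScalarsL_real_le_one h' hB hB'

/-- Convolution with the semigroup preserves the weighted bounds, with a gain of the factor `b - a`.
In the form `(t - a) ∫₀¹ S((t - a)(1 - σ)) F(a + (t - a)σ) dσ` each derivative in `t` costs a factor
`(t - a)⁻¹`, uniformly in `σ`, although `S` and `F` are singular at opposite end points. -/
theorem WeightedDerivBound.convolution [CompleteSpace X] {k : ℕ} {a b B C : ℝ} {F : ℝ → X}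
    (hS : WeightedDerivBound k a b C (fun t => S ((t - a : ℝ) : ℂ)))
    (hF : WeightedDerivBound k a b B F) (hab : a ≤ b) (hC : 0 ≤ C) (hB : 0 ≤ B) :
    WeightedDerivBound k a b (2 ^ k * (b - a) * (2 ^ k * C * B))
      (fun t => ∫ s in a..t, S ((t - s : ℝ) : ℂ) (F s)) := by
  set μ := MeasureTheory.volume.restrict (Ioo (0 : ℝ) 1) with hμ
  have : MeasureTheory.IsProbabilityMeasure μ := ⟨by simp [hμ]⟩
  -- on the open interval both contraction factors `σ` and `1 - σ` are positive
  have hψ : WeightedDerivBound k a b (2 ^ k * C * B) (fun t =>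
      ∫ σ, S ((a + (t - a) * (1 - σ) - a : ℝ) : ℂ) (F (a + (t - a) * σ)) ∂μ) := by
    refine WeightedDerivBound.integral
      (φ := fun σ t => S ((a + (t - a) * (1 - σ) - a : ℝ) : ℂ) (F (a + (t - a) * σ))) ?_ ?_
    · intro t ht
      have hpos := sub_pos.2 ht.1
      have hmaps : ∀ σ ∈ Ioo (0 : ℝ) 1, a + (t - a) * σ ∈ Ioc a b := fun σ hσ =>
        ⟨by linarith [mul_pos hpos hσ.1], by
          linarith [mul_le_of_le_one_right hpos.le hσ.2.le, ht.2]⟩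
      refine ContinuousOn.aestronglyMeasurable ?_ measurableSet_Ioo
      refine ContinuousOn.clm_apply ?_ ?_
      · exact hS.1.continuousOn.comp (f := fun σ => a + (t - a) * (1 - σ)) (by fun_prop)
          fun σ hσ => hmaps (1 - σ) ⟨by linarith [hσ.2], by linarith [hσ.1]⟩
      · exact hF.1.continuousOn.comp (by fun_prop) hmaps
    · rw [hμ, MeasureTheory.ae_restrict_iff' measurableSet_Ioo]
      refine Eventually.of_forall fun σ hσ => ?_
      exact (hS.comp_contraction (σ := 1 - σ) (by linarith [hσ.2]) (by linarith [hσ.1])).clm_apply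
        (hF.comp_contraction hσ.1 hσ.2.le) hC hB
  have key := (WeightedDerivBound.sub_left hab).bilinear (ContinuousLinearMap.lsmul ℝ ℝ)
    ContinuousLinearMap.opNorm_lsmul_le hψ (sub_nonneg.2 hab) (by positivity)
  refine key.congr fun t ht => ?_
  have := intervalIntegral.smul_integral_comp_add_mul (a := 0) (b := 1)
    (fun s => S ((t - s : ℝ) : ℂ) (F s)) (t - a) a
  simp only [mul_zero, add_zero, mul_one, add_sub_cancel] at this
  dsimp only
  rw [← this, intervalIntegral.integral_of_le zero_le_one,
    MeasureTheory.integral_Ioc_eq_integral_Ioo, ContinuousLinearMap.lsmul_apply]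
  congr 1
  refine MeasureTheory.integral_congr_ae (Eventually.of_forall fun σ => ?_)
  dsimp only
  congr 3
  ring_nf

end Semigroup

/-! ### The source term along a curve -/

section Source

variable {X : Type*} [NormedAddCommGroup X] [NormedSpace ℝ X] {f : ℝ → X → X} {T : ℝ}

/-- A smooth source maps weighted bounds to weighted bounds: the orders in each product of derivatives
add up to at most `ℓ`, so the product is of size `(t - a)^{-ℓ}`. -/
theorem IsSmoothSource.exists_weightedDerivBound (hf : IsSmoothSource f T) (k : ℕ) (R : ℝ) {P : ℝ}
    (hP : 1 ≤ P) :
    ∃ Q ≥ 0, ∀ a b : ℝ, 0 ≤ a → b ≤ T → b - a ≤ 1 → ∀ v : ℝ → X,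
      WeightedDerivBound k a b P v → (∀ t ∈ Ioc a b, ‖v t‖ ≤ R) →
        WeightedDerivBound k a b Q (fun t => f t (v t)) := by
  choose C hC using fun ℓ => hf ℓ R
  set q : ℕ → ℝ := fun ℓ =>
    |C ℓ| * ∑ j ∈ Finset.range (ℓ + 1), ∑ _m ∈ derivOrders ℓ j, P ^ ℓ
  have hP0 : 0 ≤ P := zero_le_one.trans hP
  have hq0 : ∀ ℓ, 0 ≤ q ℓ := fun ℓ => mul_nonneg (abs_nonneg _)
    (Finset.sum_nonneg fun _ _ => Finset.sum_nonneg fun _ _ => pow_nonneg hP0 _)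
  refine ⟨∑ ℓ ∈ Finset.range (k + 1), q ℓ, Finset.sum_nonneg fun ℓ _ => hq0 ℓ, ?_⟩
  intro a b ha hb hab v hv hvR
  -- the hypothesis on `f` concerns compact intervals, so `(a, b]` is exhausted by `[c, b]`
  have hmid : ∀ t ∈ Ioc a b, ∃ c, a < c ∧ c < t ∧ Ioc a b =ᶠ[𝓝 t] Icc c b := by
    intro t ht
    obtain ⟨c, hac, hct⟩ := exists_between ht.1
    refine ⟨c, hac, hct, ?_⟩
    filter_upwards [Ioi_mem_nhds hct] with x hx
    exact propext ⟨fun h => ⟨(show c < x from hx).le, h.2⟩, fun h => ⟨hac.trans hx, h.2⟩⟩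
  have hvc : ∀ ℓ ≤ k, ∀ c > a, ContDiffOn ℝ ℓ v (Icc c b) := fun ℓ hℓ c hc =>
    (hv.1.of_le (by exact_mod_cast hℓ)).mono fun x hx => ⟨hc.trans_le hx.1, hx.2⟩
  refine ⟨fun t ht => ?_, fun ℓ hℓ t ht => ?_⟩
  · obtain ⟨c, hac, hct, hcs⟩ := hmid t ht
    have := (hC k c b (ha.trans hac.le) (hct.trans_le ht.2) hb v (hvc k le_rfl c hac)).1 t
      ⟨hct.le, ht.2⟩
    exact this.congr_set hcs.symm
  · obtain ⟨c, hac, hct, hcs⟩ := hmid t ht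
    have h0 : 0 < t - a := sub_pos.2 ht.1
    have h1 : t - a ≤ 1 := by linarith [ht.2]
    have := (hC ℓ c b (ha.trans hac.le) (hct.trans_le ht.2) hb v (hvc ℓ hℓ c hac)).2 t
      ⟨hct.le, ht.2⟩ (hvR t ht)
    rw [iteratedDerivWithin_eq_of_eventuallyEq_set hcs]
    have hprod : ∀ j ∈ Finset.range (ℓ + 1), ∀ m ∈ derivOrders ℓ j,
        (t - a) ^ ℓ * ∏ i, ‖iteratedDerivWithin (m i) v (Icc c b) t‖ ≤ P ^ ℓ := by
      intro j hj m hm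
      obtain ⟨hm1, hm2⟩ := Finset.mem_filter.1 hm
      have hm1 : ∀ i, 1 ≤ m i ∧ m i ≤ ℓ := fun i =>
        Finset.mem_Icc.1 (Fintype.mem_piFinset.1 hm1 i)
      calc _ ≤ (t - a) ^ (∑ i, m i) * ∏ i, ‖iteratedDerivWithin (m i) v (Icc c b) t‖ :=
            mul_le_mul_of_nonneg_right (pow_le_pow_of_le_one h0.le h1 hm2) (by positivity)
        _ = ∏ i, ((t - a) ^ m i * ‖iteratedDerivWithin (m i) v (Ioc a b) t‖) := by
            rw [Finset.prod_mul_distrib, Finset.prod_pow_eq_pow_sum]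
            simp only [iteratedDerivWithin_eq_of_eventuallyEq_set hcs]
        _ ≤ ∏ _i : Fin j, P := Finset.prod_le_prod (fun i _ => by positivity)
            fun i _ => hv.2 (m i) ((hm1 i).2.trans hℓ) t ht
        _ = P ^ j := by simp
        _ ≤ P ^ ℓ := pow_le_pow_right₀ hP (Nat.lt_succ_iff.1 (Finset.mem_range.1 hj))
    have hsum : (t - a) ^ ℓ * derivProductSum ℓ v (Icc c b) t
        ≤ ∑ j ∈ Finset.range (ℓ + 1), ∑ _m ∈ derivOrders ℓ j, P ^ ℓ := by
      rw [derivProductSum, Finset.mul_sum]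
      refine Finset.sum_le_sum fun j hj => ?_
      rw [Finset.mul_sum]
      exact Finset.sum_le_sum (hprod j hj)
    have hD0 : 0 ≤ derivProductSum ℓ v (Icc c b) t :=
      Finset.sum_nonneg fun j _ => Finset.sum_nonneg fun m _ => by positivity
    calc _ ≤ (t - a) ^ ℓ * (|C ℓ| * derivProductSum ℓ v (Icc c b) t) :=
          mul_le_mul_of_nonneg_left (this.trans
            (mul_le_mul_of_nonneg_right (le_abs_self _) hD0)) (by positivity)
      _ = |C ℓ| * ((t - a) ^ ℓ * derivProductSum ℓ v (Icc c b) t) := by ring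
      _ ≤ q ℓ := mul_le_mul_of_nonneg_left hsum (abs_nonneg _)
      _ ≤ _ := Finset.single_le_sum (f := q) (fun ℓ _ => hq0 ℓ)
          (Finset.mem_range.2 (Nat.lt_succ_of_le hℓ))

end Source

/-! ### Mild solutions -/

section MildSolution

variable {X : Type*} [NormedAddCommGroup X] [NormedSpace ℂ X] {S : ℂ → X →L[ℂ] X} {δ : ℝ}

theorem IsBoundedAnalyticSemigroup.intervalIntegrable_convolution
    (hS : IsBoundedAnalyticSemigroup S δ) {C : ℝ} (hC : ∀ t : ℝ, 0 ≤ t → ‖S (t : ℂ)‖ ≤ C)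
    {a b B : ℝ} {F : ℝ → X} (hF : ContinuousOn F (Ioc a b)) (hB : ∀ s ∈ Ioc a b, ‖F s‖ ≤ B)
    {t : ℝ} (ht : t ∈ Ioc a b) :
    IntervalIntegrable (fun s : ℝ => S ((t - s : ℝ) : ℂ) (F s)) MeasureTheory.volume a t := by
  have hsub : Ioo a t ⊆ Ioc a b := fun s hs => ⟨hs.1, hs.2.le.trans ht.2⟩
  have hC0 : 0 ≤ C := (norm_nonneg _).trans (hC 0 le_rfl)
  rw [intervalIntegrable_iff_integrableOn_Ioo_of_le ht.1.le]
  have hc : ContinuousOn (fun s : ℝ => S ((t - s : ℝ) : ℂ) (F s)) (Ioo a t) := by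
    refine ContinuousOn.clm_apply ?_ (hF.mono hsub)
    exact hS.analytic.continuousOn.comp (f := fun s : ℝ => ((t - s : ℝ) : ℂ))
      (by fun_prop) fun s hs => ofReal_mem_openSector hS.angle_pos (sub_pos.2 hs.2)
  refine MeasureTheory.IntegrableOn.of_bound (by simp)
    (hc.aestronglyMeasurable measurableSet_Ioo) (C * B) ?_
  rw [MeasureTheory.ae_restrict_iff' measurableSet_Ioo]
  refine Eventually.of_forall fun s hs => ?_
  exact (ContinuousLinearMap.le_opNorm _ _).trans (mul_le_mul (hC _ (sub_nonneg.2 hs.2.le))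
    (hB s (hsub hs)) (norm_nonneg _) hC0)

theorem IsBoundedAnalyticSemigroup.map_add_apply (hS : IsBoundedAnalyticSemigroup S δ) {s t : ℝ}
    (hs : 0 < s) (ht : 0 < t) (x : X) : S ((s + t : ℝ) : ℂ) x = S (s : ℂ) (S (t : ℂ) x) := by
  rw [Complex.ofReal_add, hS.map_add _ (ofReal_mem_openSector hS.angle_pos hs) _
    (ofReal_mem_openSector hS.angle_pos ht)]
  rfl

/-- A mild solution can be restarted at any time `a`.  At `a = 0` the initial value is `u₀`, which is
not required to be `u 0`. -/
theorem IsMildSolution.exists_restart [CompleteSpace X] (hS : IsBoundedAnalyticSemigroup S δ)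
    {f : ℝ → X → X} {T R : ℝ} {u₀ : X} {u : ℝ → X} (hu : IsMildSolution S f T u₀ u)
    (hu₀ : ‖u₀‖ ≤ R) (huR : ∀ t ∈ Icc 0 T, ‖u t‖ ≤ R) {a : ℝ} (ha : 0 ≤ a) :
    ∃ w : X, ‖w‖ ≤ R ∧ ∀ t ∈ Ioc a T, u t = S ((t - a : ℝ) : ℂ) w
      + ∫ s in a..t, S ((t - s : ℝ) : ℂ) (f s (u s)) := by
  rcases ha.eq_or_lt with rfl | ha
  · exact ⟨u₀, hu₀, fun t ht => by simpa using hu.eq_integral t ht⟩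
  rcases lt_or_ge T a with haT | haT
  · exact ⟨u₀, hu₀, fun t ht => absurd (ht.1.trans_le ht.2) haT.not_gt⟩
  refine ⟨u a, huR a ⟨ha.le, haT⟩, fun t ht => ?_⟩
  have hi := hu.integrable t ⟨ha.trans ht.1, ht.2⟩
  have hi1 := hi.mono_set (c := 0) (d := a)
    (by rw [uIcc_of_le ha.le, uIcc_of_le (ha.trans ht.1).le]; exact Icc_subset_Icc_right ht.1.le)
  have hi2 := hi.mono_set (c := a) (d := t)
    (by rw [uIcc_of_le ht.1.le, uIcc_of_le (ha.trans ht.1).le]; exact Icc_subset_Icc_left ha.le)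
  -- `map_add_apply` is for positive times only, so the end point `s = a` is removed
  have hsplit : ∫ s in (0 : ℝ)..a, S ((t - s : ℝ) : ℂ) (f s (u s))
      = S ((t - a : ℝ) : ℂ) (∫ s in (0 : ℝ)..a, S ((a - s : ℝ) : ℂ) (f s (u s))) := by
    rw [← ContinuousLinearMap.intervalIntegral_comp_comm _ (hu.integrable a ⟨ha, haT⟩),
      intervalIntegral.integral_of_le ha.le, intervalIntegral.integral_of_le ha.le,
      MeasureTheory.integral_Ioc_eq_integral_Ioo, MeasureTheory.integral_Ioc_eq_integral_Ioo]
    refine MeasureTheory.setIntegral_congr_fun measurableSet_Ioo fun s hs => ?_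
    rw [← hS.map_add_apply (sub_pos.2 ht.1) (sub_pos.2 hs.2), sub_add_sub_cancel]
  rw [hu.eq_integral t ⟨ha.trans ht.1, ht.2⟩, hu.eq_integral a ⟨ha, haT⟩, map_add,
    ← hS.map_add_apply (sub_pos.2 ht.1) ha, sub_add_cancel, ← hsplit,
    ← intervalIntegral.integral_add_adjacent_intervals hi1 hi2, add_assoc]

/-- The Picard iterates for the mild formulation on `[a, ∞)` with initial value `w`, starting from
the zero function. -/
noncomputable def picardIterate (S : ℂ → X →L[ℂ] X) (f : ℝ → X → X) (a : ℝ) (w : X) :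
    ℕ → ℝ → X
  | 0 => fun _ => 0
  | n + 1 => fun t => S ((t - a : ℝ) : ℂ) w
      + ∫ s in a..t, S ((t - s : ℝ) : ℂ) (f s (picardIterate S f a w n s))

/-- On intervals of length at most `τ` a mild solution obeys weighted bounds with a constant `P`; both
`τ` and `P` are independent of the position of the interval.  For such `τ` the Picard map
preserves the ball of radius `P` in the weighted `C^(k+2)` norm and halves the uniform distance to
the solution. -/
theorem IsMildSolution.exists_local_weightedDerivBound [CompleteSpace X]
    (hS : IsBoundedAnalyticSemigroup S δ) {f : ℝ → X → X} {T : ℝ}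
    (hLip : IsLocallyLipschitzSource f T) (hf : IsSmoothSource f T)
    {u₀ : X} {u : ℝ → X} (hu : IsMildSolution S f T u₀ u) (k : ℕ) :
    ∃ τ > 0, ∃ P ≥ 0, ∀ a b : ℝ, 0 ≤ a → a < b → b ≤ T → b - a ≤ τ →
      WeightedDerivBound k a b P u := by
  obtain ⟨R₁, hR₁⟩ := isCompact_Icc.exists_bound_of_continuousOn hu.continuousOn
  set R := max R₁ ‖u₀‖
  have hu₀ : ‖u₀‖ ≤ R := le_max_right _ _
  have huR : ∀ t ∈ Icc 0 T, ‖u t‖ ≤ R := fun t ht => (hR₁ t ht).trans (le_max_left _ _)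
  have hR0 : 0 ≤ R := (norm_nonneg _).trans hu₀
  obtain ⟨C, hC1, hSC⟩ := hS.exists_weightedDerivBound (k + 2)
  have hC0 : 0 ≤ C := zero_le_one.trans hC1
  have hSn : ∀ t : ℝ, 0 ≤ t → ‖S (t : ℂ)‖ ≤ C := fun t ht => hS.norm_le_of_nonneg hC1 hSC ht
  obtain ⟨L, hL⟩ := hLip (2 * R)
  -- the first summand bounds the linear evolution, the second one is left for the integral
  set P := 2 ^ (k + 2) * C * R + 1
  have hP1 : 1 ≤ P := le_add_of_nonneg_left (by positivity)
  obtain ⟨Q, hQ0, hQ⟩ := hf.exists_weightedDerivBound (k + 2) (2 * R) hP1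
  set M := 2 ^ (k + 2) * (2 ^ (k + 2) * C * Q) + 2 * (C * |L|)
  have hM0 : 0 ≤ M := by positivity
  refine ⟨min 1 (1 / (M + 1)), by positivity, P, zero_le_one.trans hP1, ?_⟩
  intro a b ha hab hb hτ
  have hba : 0 ≤ b - a := sub_nonneg.2 hab.le
  have hτ1 : b - a ≤ 1 := hτ.trans (min_le_left _ _)
  have hτM : (b - a) * M ≤ 1 := by
    have := hτ.trans (min_le_right _ _)
    rw [le_div_iff₀ (by positivity)] at this
    nlinarith
  have hconv : 2 ^ (k + 2) * (b - a) * (2 ^ (k + 2) * C * Q) ≤ 1 := by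
    have : 0 ≤ (b - a) * (2 * (C * |L|)) := by positivity
    calc _ = (b - a) * (2 ^ (k + 2) * (2 ^ (k + 2) * C * Q)) := by ring
      _ ≤ (b - a) * M := mul_le_mul_of_nonneg_left
        (le_add_of_nonneg_right (by positivity)) hba
      _ ≤ 1 := hτM
  have hcontr : C * |L| * (b - a) ≤ 1 / 2 := by
    have : (b - a) * (2 * (C * |L|)) ≤ (b - a) * M := mul_le_mul_of_nonneg_left
        (le_add_of_nonneg_left (by positivity)) hba
    linarith
  obtain ⟨w, hw, hurep⟩ := hu.exists_restart hS hu₀ huR ha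
  have hT : Ioc a b ⊆ Icc 0 T := fun t ht => ⟨ha.trans ht.1.le, ht.2.trans hb⟩
  have hfu : ContinuousOn (fun t => f t (u t)) (Icc a b) := by
    obtain ⟨_, hC'⟩ := hf 0 R
    exact (hC' a b ha hab hb u (contDiffOn_zero.2
      (hu.continuousOn.mono (Icc_subset_Icc ha hb)))).1.continuousOn
  obtain ⟨B, hB⟩ := isCompact_Icc.exists_bound_of_continuousOn hfu
  set v := picardIterate S f a w
  have hball : ∀ n, (∀ t ∈ Ioc a b, ‖v n t - u t‖ ≤ R * (1 / 2) ^ n) →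
      ∀ t ∈ Ioc a b, ‖v n t‖ ≤ 2 * R := by
    intro n hn t ht
    have h1 : R * (1 / 2) ^ n ≤ R :=
      mul_le_of_le_one_right hR0 (pow_le_one₀ (by norm_num) (by norm_num))
    calc ‖v n t‖ = ‖(v n t - u t) + u t‖ := by rw [sub_add_cancel]
      _ ≤ R * (1 / 2) ^ n + R := (norm_add_le _ _).trans (add_le_add (hn t ht) (huR t (hT ht)))
      _ ≤ 2 * R := by linarith
  have hiter : ∀ n, WeightedDerivBound (k + 2) a b P (v n) ∧
      ∀ t ∈ Ioc a b, ‖v n t - u t‖ ≤ R * (1 / 2) ^ n := by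
    intro n
    induction n with
    | zero =>
      refine ⟨WeightedDerivBound.const (c := (0 : X))
        (by simpa using zero_le_one.trans hP1), fun t ht => ?_⟩
      simpa [v, picardIterate] using huR t (hT ht)
    | succ n ih =>
      have hvn := hball n ih.2
      have hF := hQ a b ha hb hτ1 (v n) ih.1 hvn
      refine ⟨?_, fun t ht => ?_⟩
      · exact (((hSC a b).clm_apply (WeightedDerivBound.const hw) hC0 hR0).add
          ((hSC a b).convolution hF hab.le hC0 hQ0)).mono (add_le_add le_rfl hconv)
      · have i1 := hS.intervalIntegrable_convolution hSn hF.1.continuousOn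
          (fun s hs => hF.norm_le hs) ht
        have i2 := hS.intervalIntegrable_convolution hSn (hfu.mono Ioc_subset_Icc_self)
          (fun s hs => hB s (Ioc_subset_Icc_self hs)) ht
        have hdiff : v (n + 1) t - u t = ∫ s in a..t,
            (S ((t - s : ℝ) : ℂ) (f s (v n s)) - S ((t - s : ℝ) : ℂ) (f s (u s))) := by
          rw [intervalIntegral.integral_sub i1 i2, hurep t ⟨ht.1, ht.2.trans hb⟩]
          exact add_sub_add_left_eq_sub _ _ _
        rw [hdiff]
        have hstep : ∀ s ∈ uIoc a t,
            ‖S ((t - s : ℝ) : ℂ) (f s (v n s)) - S ((t - s : ℝ) : ℂ) (f s (u s))‖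
              ≤ C * (|L| * (R * (1 / 2) ^ n)) := by
          intro s hs
          rw [uIoc_of_le ht.1.le] at hs
          have hs' : s ∈ Ioc a b := ⟨hs.1, hs.2.trans ht.2⟩
          rw [← map_sub]
          refine (ContinuousLinearMap.le_opNorm _ _).trans (mul_le_mul
            (hSn _ (sub_nonneg.2 hs.2)) ?_ (norm_nonneg _) hC0)
          refine (hL s (hT hs') _ _ (hvn s hs')
            ((huR s (hT hs')).trans (by linarith))).trans ?_
          exact mul_le_mul (le_abs_self L) (ih.2 s hs') (norm_nonneg _) (abs_nonneg L)
        refine (intervalIntegral.norm_integral_le_of_norm_le_const hstep).trans ?_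
        rw [abs_of_nonneg (sub_nonneg.2 ht.1.le)]
        have hpos : 0 ≤ R * (1 / 2) ^ n := by positivity
        calc C * (|L| * (R * (1 / 2) ^ n)) * (t - a)
            ≤ C * (|L| * (R * (1 / 2) ^ n)) * (b - a) :=
              mul_le_mul_of_nonneg_left (by linarith [ht.2]) (by positivity)
          _ = C * |L| * (b - a) * (R * (1 / 2) ^ n) := by ring
          _ ≤ 1 / 2 * (R * (1 / 2) ^ n) := mul_le_mul_of_nonneg_right hcontr hpos
          _ = R * (1 / 2) ^ (n + 1) := by ring
  refine WeightedDerivBound.of_tendsto (fun n => (hiter n).1) fun t ht => ?_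
  rw [tendsto_iff_norm_sub_tendsto_zero]
  refine squeeze_zero (fun _ => norm_nonneg _) (fun n => (hiter n).2 t ht) ?_
  simpa using (tendsto_pow_atTop_nhds_zero_of_lt_one (r := (1 / 2 : ℝ)) (by norm_num)
    (by norm_num)).const_mul R

end MildSolution

theorem mainTheorem2 {X : Type*} [NormedAddCommGroup X] [NormedSpace ℂ X] [CompleteSpace X]
    (A : X →ₗ.[ℂ] X) (S : ℂ → X →L[ℂ] X) (hA : GeneratesBoundedAnalyticSemigroup A S)
    (T : ℝ) (hT : 0 < T) (f : ℝ → X → X)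
    (hLip : IsLocallyLipschitzSource f T) (hf : IsSmoothSource f T)
    (u₀ : X) (u : ℝ → X) (hu : IsMildSolution S f T u₀ u) (k : ℕ) :
    ContDiffOn ℝ k u (Ioc 0 T) ∧
      ∃ C : ℝ, ∀ ℓ : ℕ, ℓ ≤ k → ∀ t ∈ Ioc 0 T,
        ‖iteratedDerivWithin ℓ u (Ioc 0 T) t‖ ≤ C * (t ^ ℓ)⁻¹ := by
  obtain ⟨⟨δ, hS⟩, -⟩ := hA
  obtain ⟨τ, hτ, P, hP, hloc⟩ := hu.exists_local_weightedDerivBound hS hLip hf k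
  set c := min 1 (τ / (2 * T))
  have hc0 : 0 < c := by positivity
  -- every `t` has a neighbourhood in `(0, T]` of the form `(a, b]` with `t - a` comparable to `t`
  have hcover : ∀ t ∈ Ioc 0 T, ∃ a b, WeightedDerivBound k a b P u ∧ t ∈ Ioc a b ∧
      c * t ≤ t - a ∧ Ioc a b =ᶠ[𝓝 t] Ioc 0 T := by
    intro t ht
    have hct : c * t ≤ t := mul_le_of_le_one_left ht.1.le (min_le_left _ _)
    have hct' : c * t ≤ τ / 2 := by
      calc c * t ≤ τ / (2 * T) * T :=
            mul_le_mul (min_le_right _ _) ht.2 ht.1.le (by positivity)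
        _ = τ / 2 := by field_simp
    obtain ⟨a, hadef⟩ : ∃ a, a = max 0 (t - τ / 2) := ⟨_, rfl⟩
    have ha0 : 0 ≤ a := hadef ▸ le_max_left _ _
    have ha1 : t - τ / 2 ≤ a := hadef ▸ le_max_right _ _
    have hat : a < t := hadef ▸ max_lt ht.1 (by linarith)
    have htb : t < a + τ := by linarith
    refine ⟨a, min T (a + τ), hloc a _ ha0 (lt_min (hat.trans_le ht.2) (by linarith))
      (min_le_left _ _) (by linarith [min_le_right T (a + τ)]), ⟨hat, le_min ht.2 htb.le⟩, ?_, ?_⟩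
    · rcases max_choice 0 (t - τ / 2) with h | h <;> rw [hadef, h] <;> linarith
    · filter_upwards [Ioi_mem_nhds hat, Iio_mem_nhds htb] with x hx hx'
      have hx : a < x := hx
      have hx' : x < a + τ := hx'
      exact propext ⟨fun h => ⟨ha0.trans_lt hx, h.2.trans (min_le_left _ _)⟩,
        fun h => ⟨hx, le_min h.2 hx'.le⟩⟩
  refine ⟨fun t ht => ?_, P / c ^ k, fun ℓ hℓ t ht => ?_⟩
  · obtain ⟨a, b, h, htab, -, hs⟩ := hcover t ht
    exact (h.1 t htab).congr_set hs
  · obtain ⟨a, b, h, htab, hta, hs⟩ := hcover t ht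
    have hb := h.2 ℓ hℓ t htab
    rw [iteratedDerivWithin_eq_of_eventuallyEq_set hs] at hb
    have ht0 : 0 < t := ht.1
    rw [← div_eq_mul_inv, le_div_iff₀ (by positivity), le_div_iff₀ (by positivity)]
    have hck : c ^ k ≤ c ^ ℓ := pow_le_pow_of_le_one hc0.le (min_le_left _ _) hℓ
    have hpow : t ^ ℓ * c ^ k ≤ (t - a) ^ ℓ := by
      calc t ^ ℓ * c ^ k ≤ t ^ ℓ * c ^ ℓ := mul_le_mul_of_nonneg_left hck (by positivity)
        _ = (c * t) ^ ℓ := by rw [mul_pow, mul_comm]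
        _ ≤ (t - a) ^ ℓ := pow_le_pow_left₀ (by positivity) hta ℓ
    rw [mul_assoc, mul_comm]
    exact (mul_le_mul_of_nonneg_right hpow (norm_nonneg _)).trans hb
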